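/- All rings are commutative with unity. A ring $R$ is \emph{semilocal} if it has only finitely many maximal ideals, and \emph{arithmetic} if, for every maximal ideal $P$ of $R$, the ideals of the localization $R_P$ are totally ordered by inclusion. A submodule $F$ of an $R$-module $M$ is \emph{pure} if, for every $R$-module $N$, the map $F\otimes_R N\to M\otimes_R N$ induced by the inclusion is injective. Let $R$ be a semilocal arithmetic ring and let $M$ be a finitely generated $R$-module. Then $M$ has a pure-composition series with cyclic factors and an increasing annihilator sequence; that is, there are an integer $n\ge 0$ and a finite chain of submodules \[\{0\}=M_0\subsetneq M_1\subsetneq\dots\subsetneq M_n=M\] such that every $M_i$ is a pure submodule of $M$, every factor $M_i/M_{i-1}$ ($1\le i\le n$) is a cyclic $R$-module, and the annihilators $A_i=\operatorname{ann}_R(M_i/M_{i-1})$ satisfy $A_1\subseteq A_2\subseteq\dots\subseteq A_n$. -/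

import Mathlib

universe u v

/-- A module is uniserial if its submodules are totally ordered by inclusion. -/
def IsUniserialModule (R : Type u) [CommRing R] (M : Type v) [AddCommGroup M] [Module R M] : Prop :=
  ∀ N₁ N₂ : Submodule R M, N₁ ≤ N₂ ∨ N₂ ≤ N₁

/-- A commutative ring, possibly with zero divisors, is a valuation ring if it is uniserial as a
module over itself. (Mathlib's `ValuationRing` only covers domains.) -/
def IsUniserialRing (R : Type u) [CommRing R] : Prop :=
  IsUniserialModule R R

/-- A ring is arithmetic if its localization at every maximal ideal is a valuation ring. -/
def IsArithmeticRing (R : Type u) [CommRing R] : Prop :=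
  ∀ (P : Ideal R) [P.IsMaximal], IsUniserialRing (Localization.AtPrime P)

/-- A commutative ring is semilocal if it has only finitely many maximal ideals. -/
def IsSemilocalRing (R : Type u) [CommRing R] : Prop :=
  {P : Ideal R | P.IsMaximal}.Finite

/-- `F` is a pure submodule of `M`: the sequence `0 → F → M → M ⧸ F → 0` stays exact after
tensoring with any module `N`. As the tensor product is right exact, this says that
`F ⊗ N → M ⊗ N` is injective. The universe of `N` contains copies of all modules that live in the
universe of `R` or in that of `M`. -/
def IsPureSubmodule {R : Type u} [CommRing R] {M : Type v} [AddCommGroup M] [Module R M]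
    (F : Submodule R M) : Prop :=
  ∀ (N : Type (max u v)) [AddCommGroup N] [Module R N],
    Function.Injective (F.subtype.rTensor N)

/-- A finite chain `0 = M₀ ⊂ M₁ ⊂ ⋯ ⊂ Mₙ = M` of pure submodules of `M`, with strict inclusions. -/
structure PureCompositionSeries (R : Type u) [CommRing R] (M : Type v) [AddCommGroup M]
    [Module R M] where
  /-- The number `n` of factors. -/
  length : ℕ
  /-- The terms `M₀, …, Mₙ`. -/
  term : Fin (length + 1) → Submodule R M
  strictMono : StrictMono term
  term_zero : term 0 = ⊥
  term_last : term (Fin.last length) = ⊤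
  isPure : ∀ i, IsPureSubmodule (term i)

namespace PureCompositionSeries

variable {R : Type u} [CommRing R] {M : Type v} [AddCommGroup M] [Module R M]

/-- The factor `Mᵢ₊₁ / Mᵢ`, for `0 ≤ i < n`. -/
abbrev Factor (s : PureCompositionSeries R M) (i : Fin s.length) : Type v :=
  s.term i.succ ⧸ (s.term i.castSucc).submoduleOf (s.term i.succ)

/-- All the factors are cyclic modules. -/
def HasCyclicFactors (s : PureCompositionSeries R M) : Prop :=
  ∀ i, ∃ x : s.Factor i, Submodule.span R {x} = ⊤

/-- The annihilator sequence, that is, the sequence of the annihilators of the factors. -/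
def annihilatorSequence (s : PureCompositionSeries R M) (i : Fin s.length) : Ideal R :=
  Module.annihilator R (s.Factor i)

end PureCompositionSeries

/-!
Call `F` relatively divisible in `M` if `rM ∩ F = rF` for all `r`. Over a valuation ring every
finite linear system can be triangularized by divisions, so relatively divisible submodules are
pure; both notions are local, so the same holds over an arithmetic ring.

Let `M` be finitely generated over a local valuation ring with maximal ideal `𝔪`. For `s` outside
`ann M`, the submodules `M[s] + 𝔪M` are proper by Nakayama's lemma and form a chain, so they do not
cover `M`. If `x` lies in none of them, then `Rx` is relatively divisible and `ann x = ann M`.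
These conditions on `x` only depend on `x` modulo `𝔪M`. Over a semilocal ring, the Chinese remainder
theorem therefore gives a single `x` that works at every maximal ideal, and a series is obtained by
repeating the construction in `M / Rx`. The annihilator of the factor generated by `x` is the
annihilator of the whole remaining module, so the annihilators increase. As `x ∉ JM` for the
Jacobson radical `J`, the images of the terms in the Noetherian module `M / JM` grow strictly, and
the process stops.
-/

section

variable {R : Type*} [CommRing R] {M : Type*} [AddCommGroup M] [Module R M]

/-- Relatively divisible submodules: those `F` with `rM ∩ F = rF` for all `r`. Purity of `F` is
the same condition for finite linear systems instead of a single equation. -/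
def IsRDSubmodule (F : Submodule R M) : Prop :=
  ∀ (r : R) (m : M), r • m ∈ F → ∃ f ∈ F, r • f = r • m

theorem IsRDSubmodule.bot : IsRDSubmodule (⊥ : Submodule R M) :=
  fun r m h ↦ ⟨0, zero_mem _, by rw [smul_zero, (Submodule.mem_bot R).1 h]⟩

theorem IsRDSubmodule.comap_mkQ {F : Submodule R M} (hF : IsRDSubmodule F)
    {K : Submodule R (M ⧸ F)} (hK : IsRDSubmodule K) : IsRDSubmodule (K.comap F.mkQ) := by
  intro r m hrm
  obtain ⟨k, hk, hrk⟩ := hK r (F.mkQ m) (by simpa using hrm)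
  obtain ⟨k, rfl⟩ := F.mkQ_surjective k
  have hsub : r • (m - k) ∈ F := by
    rw [← F.ker_mkQ, LinearMap.mem_ker, map_smul, map_sub, smul_sub, hrk, sub_self]
  obtain ⟨f, hf, hrf⟩ := hF r (m - k) hsub
  exact ⟨k + f, add_mem hk (F.le_comap_mkQ K hf), by rw [smul_add, hrf, smul_sub, add_sub_cancel]⟩

end

section

variable {A : Type*} [CommRing A]

theorem IsUniserialRing.dvd_total (hA : IsUniserialRing A) (a b : A) : a ∣ b ∨ b ∣ a := by
  simpa only [Ideal.span_singleton_le_span_singleton] using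
    hA (Ideal.span {b}) (Ideal.span {a})

theorem IsUniserialRing.exists_forall_dvd (hA : IsUniserialRing A) {ι : Type*} [Finite ι]
    [Nonempty ι] (a : ι → A) : ∃ i, ∀ j, a i ∣ a j := by
  have hdir : Directed (fun x y : A ↦ y ∣ x) a := fun i j ↦
    (hA.dvd_total (a i) (a j)).elim (fun h ↦ ⟨i, dvd_rfl, h⟩) fun h ↦ ⟨j, h, dvd_rfl⟩
  have : IsTrans A fun x y ↦ y ∣ x := ⟨fun _ _ _ h h' ↦ h'.trans h⟩
  exact hdir.finite_le id

variable {M : Type*} [AddCommGroup M] [Module A M]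

/-- The proof is Gaussian elimination, with a coefficient dividing all others as pivot. -/
theorem IsRDSubmodule.exists_solution (hA : IsUniserialRing A) {F : Submodule A M}
    (hF : IsRDSubmodule F) {ι : Type*} [Finite ι] {n : ℕ} (r : ι → Fin n → A) (m : Fin n → M)
    (hm : ∀ i, ∑ j, r i j • m j ∈ F) :
    ∃ z : Fin n → M, (∀ j, z j ∈ F) ∧ ∀ i, ∑ j, r i j • z j = ∑ j, r i j • m j := by
  induction n with
  | zero => exact ⟨m, nofun, fun _ ↦ rfl⟩
  | succ n ih =>
    rcases isEmpty_or_nonempty ι with _ | _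
    · exact ⟨0, fun _ ↦ zero_mem _, isEmptyElim⟩
    obtain ⟨⟨i₀, j₀⟩, hpivot⟩ :=
      hA.exists_forall_dvd fun p : ι × Fin (n + 1) ↦ r p.1 p.2
    choose c hc using fun i j ↦ hpivot (i, j)
    let d := r i₀ j₀
    let r' : ι → Fin n → A := fun i j ↦ r i (j₀.succAbove j) - c i j₀ * r i₀ (j₀.succAbove j)
    have eliminate (y : Fin (n + 1) → M) (i : ι) : ∑ j, r i j • y j =
        ∑ j, r' i j • y (j₀.succAbove j) + c i j₀ • ∑ j, r i₀ j • y j := by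
      simp only [Fin.sum_univ_succAbove _ j₀, r', sub_smul, Finset.sum_sub_distrib,
        smul_add, Finset.smul_sum, smul_smul, mul_comm (c i j₀) (r i₀ j₀), ← hc i j₀]
      abel
    have pivotRow (y : Fin (n + 1) → M) : ∑ j, r i₀ j • y j =
        d • (y j₀ + ∑ j, c i₀ (j₀.succAbove j) • y (j₀.succAbove j)) := by
      simp only [Fin.sum_univ_succAbove _ j₀, smul_add, Finset.smul_sum, smul_smul, d, ← hc]
    obtain ⟨z, hzF, hz⟩ := ih r' (fun j ↦ m (j₀.succAbove j)) fun i ↦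
      eq_sub_of_add_eq (eliminate m i).symm ▸ sub_mem (hm i) (F.smul_mem _ (hm i₀))
    obtain ⟨f, hf, hdf⟩ := hF d _ (pivotRow m ▸ hm i₀)
    let z' : Fin (n + 1) → M := j₀.insertNth (f - ∑ j, c i₀ (j₀.succAbove j) • z j) z
    have row₀ : ∑ j, r i₀ j • z' j = ∑ j, r i₀ j • m j := by
      simp only [pivotRow, z', Fin.insertNth_apply_same, Fin.insertNth_apply_succAbove,
        sub_add_cancel, hdf]
    refine ⟨z', (Fin.forall_iff_succAbove j₀).2 ⟨?_, fun j ↦ ?_⟩, fun i ↦ ?_⟩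
    · simpa only [z', Fin.insertNth_apply_same] using
        sub_mem hf (sum_mem fun j _ ↦ F.smul_mem _ (hzF j))
    · simpa only [z', Fin.insertNth_apply_succAbove] using hzF j
    · rw [eliminate z', eliminate m, row₀]
      simp only [z', Fin.insertNth_apply_succAbove, hz]

end

section

open TensorProduct

variable {R : Type*} [CommRing R] {N : Type*} [AddCommGroup N] [Module R N]

theorem exists_eq_sum_tmul_of_span_range_eq_top {ι : Type*} [Fintype ι] {n : ι → N}
    (hn : Submodule.span R (Set.range n) = ⊤) {M : Type*} [AddCommGroup M] [Module R M]
    (t : N ⊗[R] M) : ∃ y : ι → M, t = ∑ i, n i ⊗ₜ[R] y i := by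
  induction t with
  | zero => exact ⟨0, by simp⟩
  | add a b ha hb =>
    obtain ⟨y, rfl⟩ := ha
    obtain ⟨z, rfl⟩ := hb
    exact ⟨y + z, by simp [tmul_add, Finset.sum_add_distrib]⟩
  | tmul a m =>
    obtain ⟨c, rfl⟩ := (Submodule.mem_span_range_iff_exists_fun R).1
      (hn ▸ Submodule.mem_top : a ∈ Submodule.span R (Set.range n))
    exact ⟨fun i ↦ c i • m, by simp [sum_tmul, smul_tmul]⟩

theorem lTensor_injective_of_forall_fg {M M' : Type*} [AddCommGroup M] [Module R M]
    [AddCommGroup M'] [Module R M'] {f : M →ₗ[R] M'}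
    (hf : ∀ Q : Submodule R N, Q.FG → Function.Injective (f.lTensor Q)) :
    Function.Injective (f.lTensor N) := by
  have comm (Q : Submodule R N) (t : Q ⊗[R] M) :
      f.lTensor N (Q.subtype.rTensor M t) = Q.subtype.rTensor M' (f.lTensor Q t) := by
    simp only [← LinearMap.comp_apply, LinearMap.lTensor_comp_rTensor,
      LinearMap.rTensor_comp_lTensor]
  rw [injective_iff_map_eq_zero]
  intro t ht
  obtain ⟨Q, hQ, t, rfl⟩ := TensorProduct.exists_of_fg t
  rw [comm] at ht
  obtain ⟨Q', hle, hQ', h⟩ := TensorProduct.eq_zero_of_fg_of_subtype_eq_zero hQ ht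
  have hincl : (Submodule.inclusion hle).rTensor M t = 0 := by
    apply hf Q' hQ'
    rw [map_zero, ← h, ← LinearMap.comp_apply, ← LinearMap.comp_apply,
      LinearMap.lTensor_comp_rTensor, LinearMap.rTensor_comp_lTensor]
  rw [← Submodule.subtype_comp_inclusion _ _ hle, LinearMap.rTensor_comp, LinearMap.comp_apply,
    hincl, map_zero]

/-- By the equational criterion, the vanishing of `∑ nᵢ ⊗ yᵢ` in `N ⊗ M`, with `yᵢ ∈ F`, amounts to
the solvability in `M` of certain linear systems with right-hand side `y`. -/
theorem IsRDSubmodule.lTensor_subtype_injective (hR : IsUniserialRing R) {M : Type*}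
    [AddCommGroup M] [Module R M] {F : Submodule R M} (hF : IsRDSubmodule F) :
    Function.Injective (F.subtype.lTensor N) := by
  refine lTensor_injective_of_forall_fg fun Q hQ ↦ (injective_iff_map_eq_zero _).2 fun t ht ↦ ?_
  have : Module.Finite R Q := Module.Finite.iff_fg.2 hQ
  obtain ⟨k, n, hn⟩ := Module.Finite.exists_fin (R := R) (M := Q)
  obtain ⟨y, rfl⟩ := exists_eq_sum_tmul_of_span_range_eq_top hn t
  obtain ⟨l, a, m, hm, ha⟩ := vanishesTrivially_of_sum_tmul_eq_zero R hn
    (n := fun i ↦ (y i : M)) (by simpa using ht)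
  obtain ⟨z, hzF, hz⟩ := hF.exists_solution hR a m fun i ↦ hm i ▸ (y i).2
  refine sum_tmul_eq_zero_of_vanishesTrivially R ⟨l, a, fun j ↦ ⟨z j, hzF j⟩, fun i ↦ ?_, ha⟩
  ext
  simp [hz, hm]

end

section

variable {R : Type*} [CommRing R] {M : Type*} [AddCommGroup M] [Module R M]

theorem mk_mem_localized_iff {S : Submonoid R} {F : Submodule R M} {m : M} {s : S} :
    LocalizedModule.mk m s ∈ F.localized S ↔ ∃ w : S, w • m ∈ F := by
  rw [IsLocalizedModule.mk_eq_mk']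
  constructor
  · rintro ⟨f, hf, t, h⟩
    obtain ⟨w, hw⟩ := (IsLocalizedModule.mk'_eq_mk'_iff _ _ _ _ _).1 h
    exact ⟨w * t, by rw [mul_smul, hw]; exact F.smul_mem _ (F.smul_mem _ hf)⟩
  · rintro ⟨w, hw⟩
    exact ⟨w • m, hw, w * s, IsLocalizedModule.mk'_cancel_left _ _ _ _⟩

theorem IsRDSubmodule.localized {F : Submodule R M} (hF : IsRDSubmodule F) (S : Submonoid R) :
    IsRDSubmodule (F.localized S) := by
  intro a m' ham
  induction m' using LocalizedModule.induction_on with | _ m s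
  induction a using Localization.induction_on with | _ p
  obtain ⟨r, t⟩ := p
  rw [LocalizedModule.mk_smul_mk] at ham ⊢
  obtain ⟨w, hw⟩ := mk_mem_localized_iff.1 ham
  obtain ⟨f, hf, hrf⟩ := hF r (w • m) (by rwa [smul_comm])
  refine ⟨LocalizedModule.mk f (w * s), mk_mem_localized_iff.2 ⟨1, by rwa [one_smul]⟩, ?_⟩
  rw [LocalizedModule.mk_smul_mk, hrf, smul_comm r w, mul_left_comm,
    LocalizedModule.mk_cancel_common_left]

open TensorProduct

theorem lTensor_restrictScalars_injective (S : Submonoid R) {A : Type*} [CommRing A] [Algebra R A]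
    [IsLocalization S A] {N M₁ M₂ : Type*} [AddCommGroup N] [AddCommGroup M₁] [AddCommGroup M₂]
    [Module R N] [Module R M₁] [Module R M₂] [Module A N] [Module A M₁] [Module A M₂]
    [IsScalarTower R A N] [IsScalarTower R A M₁] [IsScalarTower R A M₂] {f : M₁ →ₗ[A] M₂}
    (hf : Function.Injective (f.lTensor N)) :
    Function.Injective ((f.restrictScalars R).lTensor N) := by
  let e₁ := IsLocalization.moduleTensorEquiv S A N M₁
  let e₂ := IsLocalization.moduleTensorEquiv S A N M₂
  have comm : (f.restrictScalars R).lTensor N =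
      (e₂.toLinearMap ∘ₗ f.lTensor N ∘ₗ e₁.symm.toLinearMap).restrictScalars R := by
    ext; rfl
  rw [comm]
  exact e₂.injective.comp (hf.comp e₁.symm.injective)

theorem isLocalizedModule_map_lTensor_subtype (S : Submonoid R) (F : Submodule R M) (N : Type*)
    [AddCommGroup N] [Module R N] :
    IsLocalizedModule.map S
        (map (LocalizedModule.mkLinearMap S N) (F.toLocalized S))
        (map (LocalizedModule.mkLinearMap S N) (LocalizedModule.mkLinearMap S M))
        (F.subtype.lTensor N) =
      ((F.localized S).subtype.restrictScalars R).lTensor (LocalizedModule S N) := by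
  apply IsLocalizedModule.linearMap_ext S
    (map (LocalizedModule.mkLinearMap S N) (F.toLocalized S))
    (map (LocalizedModule.mkLinearMap S N) (LocalizedModule.mkLinearMap S M))
  rw [IsLocalizedModule.map_comp]
  ext
  rfl

theorem IsRDSubmodule.isPureSubmodule (hR : IsArithmeticRing R) {F : Submodule R M}
    (hF : IsRDSubmodule F) : IsPureSubmodule F := by
  intro N _ _
  rw [← LinearMap.lTensor_inj_iff_rTensor_inj]
  refine injective_of_isLocalized_maximal _
    (fun P _ ↦ map (LocalizedModule.mkLinearMap P.primeCompl N) (F.toLocalized P.primeCompl)) _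
    (fun P _ ↦ map (LocalizedModule.mkLinearMap P.primeCompl N)
      (LocalizedModule.mkLinearMap P.primeCompl M)) _ fun P _ ↦ ?_
  rw [isLocalizedModule_map_lTensor_subtype]
  exact lTensor_restrictScalars_injective P.primeCompl
    ((hF.localized P.primeCompl).lTensor_subtype_injective (hR P))

end

section

open IsLocalRing

variable {A : Type*} [CommRing A] [IsLocalRing A] {M : Type*} [AddCommGroup M] [Module A M]

/-- An element of a module over a local ring `(A, 𝔪)` is stably faithful if every `s` that kills
some element congruent to it modulo `𝔪M` kills the whole of `M`. These are the elements that
generate the bottom term of a pure-composition series. -/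
def IsStablyFaithful (A : Type*) [CommRing A] [IsLocalRing A] {M : Type*} [AddCommGroup M]
    [Module A M] (x : M) : Prop :=
  ∀ s : A, x ∈ Submodule.torsionBy A M s ⊔ maximalIdeal A • (⊤ : Submodule A M) →
    s ∈ Module.annihilator A M

theorem torsionBy_sup_smul_top_ne_top [Module.Finite A M] {s : A}
    (hs : s ∉ Module.annihilator A M) :
    Submodule.torsionBy A M s ⊔ maximalIdeal A • (⊤ : Submodule A M) ≠ ⊤ := by
  intro h
  have htop : ⊤ ≤ Submodule.torsionBy A M s :=
    Submodule.le_of_le_smul_of_le_jacobson_bot Module.Finite.fg_top (maximalIdeal_le_jacobson ⊥)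
      h.ge
  exact hs (Module.mem_annihilator.2 fun m ↦ htop (Submodule.mem_top (x := m)))

theorem IsUniserialRing.exists_isStablyFaithful (hA : IsUniserialRing A) [Module.Finite A M] :
    ∃ x : M, IsStablyFaithful A x := by
  rcases isEmpty_or_nonempty {s : A // s ∉ Module.annihilator A M} with hempty | _
  · exact ⟨0, fun s _ ↦ by_contra fun hs ↦ hempty.false ⟨s, hs⟩⟩
  let N (s : {s : A // s ∉ Module.annihilator A M}) : Submodule A M :=
    Submodule.torsionBy A M s.1 ⊔ maximalIdeal A • ⊤
  have hN {s t} (h : s.1 ∣ t.1) : N s ≤ N t :=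
    sup_le_sup_right (Submodule.torsionBy_le_torsionBy_of_dvd _ _ h) _
  have hdir : Directed (· ≤ ·) N := fun s t ↦ (hA.dvd_total s.1 t.1).elim
    (fun h ↦ ⟨t, hN h, le_rfl⟩) fun h ↦ ⟨s, le_rfl, hN h⟩
  have hlt : ⨆ s, N s < ⊤ :=
    CompleteLattice.IsCompactElement.directed_sSup_lt_of_lt
      ((Submodule.fg_iff_compact _).1 Module.Finite.fg_top) (Set.range_nonempty N)
      hdir.directedOn_range
      (Set.forall_mem_range.2 fun s ↦ (torsionBy_sup_smul_top_ne_top s.2).lt_top)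
  obtain ⟨x, -, hx⟩ := SetLike.exists_of_lt hlt
  exact ⟨x, fun s hxs ↦ by_contra fun hs ↦ hx (Submodule.mem_iSup_of_mem ⟨s, hs⟩ hxs)⟩

theorem IsStablyFaithful.congr {x y : M} (hx : IsStablyFaithful A x)
    (hxy : x - y ∈ maximalIdeal A • (⊤ : Submodule A M)) : IsStablyFaithful A y :=
  fun s hs ↦ hx s (sub_add_cancel x y ▸ add_mem (Submodule.mem_sup_right hxy) hs)

theorem IsStablyFaithful.of_smul {u : A} {x : M} (hx : IsStablyFaithful A (u • x)) :
    IsStablyFaithful A x :=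
  fun s hs ↦ hx s (Submodule.smul_mem _ u hs)

theorem IsStablyFaithful.mem_annihilator {x : M} (hx : IsStablyFaithful A x) {s : A}
    (hs : s • x = 0) : s ∈ Module.annihilator A M :=
  hx s (Submodule.mem_sup_left hs)

theorem IsStablyFaithful.notMem_smul_top [Nontrivial M] {x : M} (hx : IsStablyFaithful A x) :
    x ∉ maximalIdeal A • (⊤ : Submodule A M) := by
  intro h
  have h1 : (1 : A) ∈ Module.annihilator A M := hx 1 (Submodule.mem_sup_right h)
  obtain ⟨m, hm⟩ := exists_ne (0 : M)
  exact hm (by simpa using Module.mem_annihilator.1 h1 m)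

theorem IsStablyFaithful.isRDSubmodule_span (hA : IsUniserialRing A) {x : M}
    (hx : IsStablyFaithful A x) : IsRDSubmodule (Submodule.span A {x}) := by
  intro r m hrm
  obtain ⟨s, hs⟩ := Submodule.mem_span_singleton.1 hrm
  by_cases hdvd : r ∣ s
  · obtain ⟨c, rfl⟩ := hdvd
    exact ⟨c • x, Submodule.smul_mem _ c (Submodule.mem_span_singleton_self x),
      by rw [smul_smul, hs]⟩
  obtain ⟨c, rfl⟩ := (hA.dvd_total r s).resolve_left hdvd
  have hc : c ∈ maximalIdeal A :=
    (mem_maximalIdeal c).2 fun hunit ↦ hdvd (hunit.mul_right_dvd.2 dvd_rfl)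
  -- `s` kills `x - c • m`, which is congruent to `x`, hence it kills `M`.
  have hker : s • (x - c • m) = 0 := by rw [smul_sub, hs, smul_smul, sub_self]
  have hs' : s ∈ Module.annihilator A M := hx s <| Submodule.mem_sup.2
    ⟨_, hker, c • m, Submodule.smul_mem_smul hc Submodule.mem_top, sub_add_cancel _ _⟩
  refine ⟨0, zero_mem _, ?_⟩
  rw [smul_zero, mul_comm, mul_smul, Module.mem_annihilator.1 hs', smul_zero]

end

section

variable {R : Type*} [CommRing R] {M : Type*} [AddCommGroup M] [Module R M]

theorem IsRDSubmodule.of_localized_maximal {F : Submodule R M}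
    (hF : ∀ (P : Ideal R) [P.IsMaximal], IsRDSubmodule (F.localized P.primeCompl)) :
    IsRDSubmodule F := by
  intro r m hrm
  suffices h : r • m ∈ F.map (LinearMap.lsmul R M r) from (Submodule.mem_map).1 h
  refine Submodule.mem_of_localization_maximal (fun P _ ↦ LocalizedModule P.primeCompl M)
    (fun P _ ↦ LocalizedModule.mkLinearMap P.primeCompl M) _ _ fun P _ ↦ ?_
  obtain ⟨f', ⟨f, hf, s, rfl⟩, h⟩ := hF P (algebraMap R _ r) (LocalizedModule.mk m 1) <| by
    rw [algebraMap_smul, LocalizedModule.smul'_mk]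
    exact mk_mem_localized_iff.2 ⟨1, by rwa [one_smul]⟩
  rw [← IsLocalizedModule.mk_eq_mk', algebraMap_smul, algebraMap_smul, LocalizedModule.smul'_mk,
    LocalizedModule.smul'_mk, LocalizedModule.mk_eq] at h
  obtain ⟨w, hw⟩ := h
  refine mk_mem_localized_iff.2 ⟨w * s, w • f, F.smul_mem _ hf, ?_⟩
  simp only [LinearMap.lsmul_apply, mul_smul, Submonoid.smul_def, one_smul] at hw ⊢
  rw [smul_comm, hw]

/-- An element of a module is locally stably faithful if its image in the localization at every
maximal ideal is stably faithful. -/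
def IsLocallyStablyFaithful (R : Type*) [CommRing R] {M : Type*} [AddCommGroup M] [Module R M]
    (x : M) : Prop :=
  ∀ (P : Ideal R) [P.IsMaximal],
    IsStablyFaithful (Localization.AtPrime P) (LocalizedModule.mkLinearMap P.primeCompl M x)

theorem IsArithmeticRing.exists_isStablyFaithful_mkLinearMap (hR : IsArithmeticRing R)
    [Module.Finite R M] (P : Ideal R) [P.IsMaximal] : ∃ x : M,
      IsStablyFaithful (Localization.AtPrime P) (LocalizedModule.mkLinearMap P.primeCompl M x) := by
  obtain ⟨z, hz⟩ := (hR P).exists_isStablyFaithful (M := LocalizedModule P.primeCompl M)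
  induction z using LocalizedModule.induction_on with | _ x s
  refine ⟨x, .of_smul (u := Localization.mk 1 s) ?_⟩
  simpa [LocalizedModule.mkLinearMap_apply, LocalizedModule.mk_smul_mk] using hz

theorem mkLinearMap_mem_maximalIdeal_smul_top (P : Ideal R) [P.IsMaximal] {m : M}
    (hm : m ∈ P • (⊤ : Submodule R M)) : LocalizedModule.mkLinearMap P.primeCompl M m ∈
      IsLocalRing.maximalIdeal (Localization.AtPrime P) • (⊤ : Submodule (Localization.AtPrime P)
        (LocalizedModule P.primeCompl M)) := by
  refine Submodule.smul_induction_on hm (fun r hr m _ ↦ ?_) fun a b ha hb ↦ ?_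
  · rw [map_smul, ← algebraMap_smul (Localization.AtPrime P) r]
    exact Submodule.smul_mem_smul
      ((IsLocalization.AtPrime.to_map_mem_maximal_iff _ P r).2 hr) Submodule.mem_top
  · exact map_add (LocalizedModule.mkLinearMap P.primeCompl M) a b ▸ add_mem ha hb

theorem exists_forall_sub_mem_smul_top [Finite (MaximalSpectrum R)] (x : MaximalSpectrum R → M) :
    ∃ y : M, ∀ P, x P - y ∈ P.asIdeal • (⊤ : Submodule R M) := by
  obtain ⟨y, hy⟩ := Ideal.pi_tensorProductMk_quotient_surjective M
    (fun P : MaximalSpectrum R ↦ P.asIdeal)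
    (fun _ _ hne ↦ Ideal.isCoprime_of_isMaximal (MaximalSpectrum.ext_iff.ne.mp hne))
    fun P ↦ TensorProduct.mk R (R ⧸ P.asIdeal) M 1 (x P)
  refine ⟨y, fun P ↦ ?_⟩
  rw [← LinearMap.ker_tensorProductMk, LinearMap.mem_ker, map_sub, ← congrFun hy P]
  exact sub_self _

theorem IsArithmeticRing.exists_isLocallyStablyFaithful [Finite (MaximalSpectrum R)]
    (hR : IsArithmeticRing R) [Module.Finite R M] : ∃ x : M, IsLocallyStablyFaithful R x := by
  choose x hx using fun P : MaximalSpectrum R ↦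
    hR.exists_isStablyFaithful_mkLinearMap (M := M) P.asIdeal
  obtain ⟨y, hy⟩ := exists_forall_sub_mem_smul_top x
  refine ⟨y, fun P hP ↦ (hx ⟨P, hP⟩).congr ?_⟩
  rw [← map_sub]
  exact mkLinearMap_mem_maximalIdeal_smul_top P (hy ⟨P, hP⟩)

theorem IsLocallyStablyFaithful.isRDSubmodule_span (hR : IsArithmeticRing R) {x : M}
    (hx : IsLocallyStablyFaithful R x) : IsRDSubmodule (Submodule.span R {x}) := by
  refine .of_localized_maximal fun P _ ↦ ?_
  rw [Submodule.localized, Submodule.localized'_span, Set.image_singleton]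
  exact (hx P).isRDSubmodule_span (hR P)

theorem IsLocallyStablyFaithful.mem_annihilator {x : M} (hx : IsLocallyStablyFaithful R x) {r : R}
    (hr : r • x = 0) : r ∈ Module.annihilator R M := by
  refine Module.mem_annihilator.2 fun m ↦ Module.eq_zero_of_localization_maximal
    (fun (P : Ideal R) _ ↦ LocalizedModule P.primeCompl M)
    (fun P _ ↦ LocalizedModule.mkLinearMap P.primeCompl M) _ fun P _ ↦ ?_
  have hann := (hx P).mem_annihilator (s := algebraMap R _ r) <| by
    rw [algebraMap_smul, ← map_smul, hr, map_zero]
  rw [map_smul, ← algebraMap_smul (Localization.AtPrime P), Module.mem_annihilator.1 hann]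

theorem IsLocallyStablyFaithful.notMem_jacobson_smul_top [Nontrivial M] {x : M}
    (hx : IsLocallyStablyFaithful R x) : x ∉ Ring.jacobson R • (⊤ : Submodule R M) := by
  intro hmem
  refine not_subsingleton M (Module.subsingleton_of_localization_maximal
    (fun (P : Ideal R) _ ↦ LocalizedModule P.primeCompl M)
    (fun P _ ↦ LocalizedModule.mkLinearMap P.primeCompl M) fun P hP ↦ ?_)
  by_contra hnontrivial
  rw [not_subsingleton_iff_nontrivial] at hnontrivial
  exact (hx P).notMem_smul_top (mkLinearMap_mem_maximalIdeal_smul_top P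
    (Submodule.smul_mono_left (Ring.jacobson_eq_sInf_isMaximal R ▸ sInf_le hP) hmem))

theorem isSemisimpleRing_quotient_jacobson [Finite (MaximalSpectrum R)] :
    IsSemisimpleRing (R ⧸ Ring.jacobson R) := by
  have (P : MaximalSpectrum R) : IsSemisimpleRing (R ⧸ P.asIdeal) :=
    let _ := Ideal.Quotient.field P.asIdeal; inferInstance
  have hJ : Ring.jacobson R = ⨅ P : MaximalSpectrum R, P.asIdeal := by
    rw [Ring.jacobson_eq_sInf_isMaximal, ← MaximalSpectrum.range_asIdeal, sInf_range]
  rw [hJ]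
  exact (Ideal.quotientInfRingEquivPiQuotient _ fun P Q hne ↦
    Ideal.isCoprime_of_isMaximal (MaximalSpectrum.ext_iff.ne.mp hne)).symm.isSemisimpleRing

theorem isNoetherian_quotient_jacobson_smul_top [Finite (MaximalSpectrum R)] [Module.Finite R M] :
    IsNoetherian R (M ⧸ Ring.jacobson R • (⊤ : Submodule R M)) := by
  have := isSemisimpleRing_quotient_jacobson (R := R)
  have : Module.Finite (R ⧸ Ring.jacobson R) (M ⧸ Ring.jacobson R • (⊤ : Submodule R M)) :=
    Module.Finite.of_restrictScalars_finite R _ _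
  let e : (M ⧸ Ring.jacobson R • (⊤ : Submodule R M)) →ₛₗ[Ideal.Quotient.mk (Ring.jacobson R)]
      M ⧸ Ring.jacobson R • (⊤ : Submodule R M) :=
    ⟨AddHom.id _, fun _ _ ↦ rfl⟩
  rw [e.isNoetherian_iff_of_bijective Function.bijective_id]
  infer_instance

end

section

variable {R : Type*} [CommRing R] {M : Type*} [AddCommGroup M] [Module R M]

/-- `G / F` is isomorphic to `K`, where `G` is the submodule of `M` that corresponds to the
submodule `K` of `M / F`. -/
noncomputable def comapMkQQuotientEquiv {F : Submodule R M} (K : Submodule R (M ⧸ F)) :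
    (K.comap F.mkQ ⧸ F.submoduleOf (K.comap F.mkQ)) ≃ₗ[R] K :=
  (Submodule.quotEquivOfEq _ _ <| by
    ext; simp [Submodule.submoduleOf, Subtype.ext_iff]).trans <|
    (F.mkQ.submoduleComap K).quotKerEquivOfSurjective
      (F.mkQ.submoduleComap_surjective_of_surjective K F.mkQ_surjective)

/-- The relation between consecutive terms of a pure-composition series: `G` is an RD-submodule
that strictly contains `F`, and `G / F` is cyclic with the same annihilator as `M / F`. (The
other inclusion of annihilators always holds.) -/
structure IsCyclicRDStep (F G : Submodule R M) : Prop where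
  lt : F < G
  isRDSubmodule : IsRDSubmodule G
  exists_span_singleton_eq_top : ∃ x : G ⧸ F.submoduleOf G, Submodule.span R {x} = ⊤
  annihilator_le : Module.annihilator R (G ⧸ F.submoduleOf G) ≤ Module.annihilator R (M ⧸ F)

theorem lt_comap_mkQ_span_singleton {F : Submodule R M} {x : M ⧸ F} (hx : x ≠ 0) :
    F < (Submodule.span R {x}).comap F.mkQ := by
  obtain ⟨m, rfl⟩ := F.mkQ_surjective x
  exact SetLike.lt_iff_le_and_exists.2 ⟨F.le_comap_mkQ _, m,
    Submodule.mem_span_singleton_self _, fun hm ↦ hx ((Submodule.Quotient.mk_eq_zero F).2 hm)⟩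

theorem map_mkQ_lt_map_mkQ_comap_span_singleton (I : Ideal R) {F : Submodule R M} {x : M ⧸ F}
    (hx : x ∉ I • (⊤ : Submodule R (M ⧸ F))) :
    F.map (I • (⊤ : Submodule R M)).mkQ <
      ((Submodule.span R {x}).comap F.mkQ).map (I • (⊤ : Submodule R M)).mkQ := by
  obtain ⟨m, rfl⟩ := F.mkQ_surjective x
  refine SetLike.lt_iff_le_and_exists.2 ⟨Submodule.map_mono (F.le_comap_mkQ _), _,
    Submodule.mem_map_of_mem (Submodule.mem_span_singleton_self (F.mkQ m)), fun hm ↦ hx ?_⟩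
  obtain ⟨f, hf, hfm⟩ := hm
  have hsub : m - f ∈ I • (⊤ : Submodule R M) := (Submodule.Quotient.eq _).1 hfm.symm
  have hmap := Submodule.mem_map_of_mem (f := F.mkQ) hsub
  rwa [Submodule.map_smul'', Submodule.map_top, F.range_mkQ, map_sub, F.mkQ_apply f,
    (Submodule.Quotient.mk_eq_zero F).2 hf, sub_zero] at hmap

theorem IsLocallyStablyFaithful.isCyclicRDStep (hR : IsArithmeticRing R) {F : Submodule R M}
    (hF : IsRDSubmodule F) {x : M ⧸ F} (hx : IsLocallyStablyFaithful R x) (hx0 : x ≠ 0) :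
    IsCyclicRDStep F ((Submodule.span R {x}).comap F.mkQ) := by
  let K := Submodule.span R {x}
  have hxK : x ∈ K := Submodule.mem_span_singleton_self x
  let e := comapMkQQuotientEquiv K
  refine ⟨lt_comap_mkQ_span_singleton hx0, hF.comap_mkQ (hx.isRDSubmodule_span hR),
    ⟨e.symm ⟨x, hxK⟩, ?_⟩, ?_⟩
  · have hK : Submodule.span R {(⟨x, hxK⟩ : K)} = ⊤ := by
      rw [← LinearMap.submoduleOf_span_singleton_of_mem, Submodule.submoduleOf_self]
    rw [← Set.image_singleton, ← LinearEquiv.coe_coe, ← Submodule.map_span, hK,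
      Submodule.map_top, LinearEquiv.range]
  · intro r hr
    rw [e.annihilator_eq, Module.mem_annihilator] at hr
    exact hx.mem_annihilator (congrArg Subtype.val (hr ⟨x, hxK⟩))

theorem IsRDSubmodule.exists_relSeries [Finite (MaximalSpectrum R)] (hR : IsArithmeticRing R)
    [Module.Finite R M] {F : Submodule R M} (hF : IsRDSubmodule F) :
    ∃ p : RelSeries {(F, G) : Submodule R M × Submodule R M | IsCyclicRDStep F G},
      p.head = F ∧ p.last = ⊤ := by
  let J := Ring.jacobson R • (⊤ : Submodule R M)
  have : IsNoetherian R (M ⧸ J) := isNoetherian_quotient_jacobson_smul_top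
  induction F using (InvImage.wf (Submodule.map J.mkQ) wellFounded_gt).induction with
  | _ F ih =>
    by_cases htop : F = ⊤
    · exact ⟨.singleton _ F, rfl, htop⟩
    have : Nontrivial (M ⧸ F) := Submodule.Quotient.nontrivial_iff.2 htop
    obtain ⟨x, hx⟩ := hR.exists_isLocallyStablyFaithful (M := M ⧸ F)
    have hxJ : x ∉ Ring.jacobson R • (⊤ : Submodule R (M ⧸ F)) := hx.notMem_jacobson_smul_top
    have hstep := hx.isCyclicRDStep hR hF fun h ↦ hxJ (h ▸ zero_mem _)
    obtain ⟨p, hhead, hlast⟩ :=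
      ih _ (map_mkQ_lt_map_mkQ_comap_span_singleton _ hxJ) hstep.isRDSubmodule
    exact ⟨p.cons F (hhead ▸ hstep), p.head_cons _ _, (p.last_cons _ _).trans hlast⟩

end

theorem annihilator_quotient_le_annihilator_quotient_submoduleOf {R : Type*} [CommRing R]
    {M : Type*} [AddCommGroup M] [Module R M] (F G : Submodule R M) :
    Module.annihilator R (M ⧸ F) ≤ Module.annihilator R (G ⧸ F.submoduleOf G) := by
  intro r hr
  refine Module.mem_annihilator.2 ((Submodule.Quotient.mk_surjective _).forall.2 fun g ↦ ?_)
  exact (Submodule.Quotient.mk_eq_zero _).2 <| (Submodule.Quotient.mk_eq_zero F).1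
    (Module.mem_annihilator.1 hr (Submodule.Quotient.mk (g : M)))

theorem mainTheorem9 (R : Type u) [CommRing R] (hsemilocal : IsSemilocalRing R)
    (harith : IsArithmeticRing R) (M : Type v) [AddCommGroup M] [Module R M] [Module.Finite R M] :
    ∃ s : PureCompositionSeries R M, s.HasCyclicFactors ∧ Monotone s.annihilatorSequence := by
  have : Finite (MaximalSpectrum R) :=
    (MaximalSpectrum.equivSubtype R).finite_iff.2 (Set.finite_coe_iff.2 hsemilocal)
  obtain ⟨p, hhead, hlast⟩ := (IsRDSubmodule.bot (R := R) (M := M)).exists_relSeries harith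
  have step (i : Fin p.length) : IsCyclicRDStep (p i.castSucc) (p i.succ) := p.step i
  have hmono : StrictMono p := Fin.strictMono_iff_lt_succ.2 fun i ↦ (step i).lt
  have hRD (i) : IsRDSubmodule (p i) := by
    induction i using Fin.cases with
    | zero => exact (show p 0 = ⊥ from hhead) ▸ .bot
    | succ i => exact (step i).isRDSubmodule
  refine ⟨⟨p.length, p, hmono, hhead, hlast, fun i ↦ (hRD i).isPureSubmodule harith⟩,
    fun i ↦ (step i).exists_span_singleton_eq_top, fun i j hij ↦ (step i).annihilator_le.trans ?_⟩
  have hle : p i.castSucc ≤ p j.castSucc := hmono.monotone (Fin.castSucc_le_castSucc_iff.2 hij)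
  have hquot : Module.annihilator R (M ⧸ p i.castSucc) ≤ Module.annihilator R (M ⧸ p j.castSucc) :=
    (Submodule.factor hle).annihilator_le_of_surjective (Submodule.factor_surjective hle)
  exact hquot.trans (annihilator_quotient_le_annihilator_quotient_submoduleOf _ _)
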